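/- For each integer $N\ge 1$ let $\mathcal L(N)$ be the set of all polynomials $f(z)=c_0+c_1z+\dots+c_{N-1}z^{N-1}$ with every coefficient $c_j\in\{1,-1\}$, and let $D_N(z)=1+z+\dots+z^{N-1}\in\mathcal L(N)$. For a real number $p>0$ and a measurable function $g$ on $[0,2\pi]$ write $\|g\|_p=\left(\int_0^{2\pi}|g(\theta)|^p\,d\theta\right)^{1/p}$. Let $K\ge 1$ and $N_1,\dots,N_K\ge 1$ be integers, let $f_k\in\mathcal L(N_k)$, and let $t_k>0$ be real numbers, for $1\le k\le K$. Then $$\left\|\Bigl(\sum_{k=1}^K t_k|D_{N_k}(e^{i\theta})|^2\Bigr)^{1/2}\right\|_p\le\left\|\Bigl(\sum_{k=1}^K t_k|f_k(e^{i\theta})|^2\Bigr)^{1/2}\right\|_p\qquad\text{for all real } 0<p\le 2,$$ and $$\left\|\Bigl(\sum_{k=1}^K t_k|D_{N_k}(e^{i\theta})|^2\Bigr)^{1/2}\right\|_p\ge\left\|\Bigl(\sum_{k=1}^K t_k|f_k(e^{i\theta})|^2\Bigr)^{1/2}\right\|_p\qquad\text{for all real } 2\le p\le 4.$$ -/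

import Mathlib

open MeasureTheory

/-- The Littlewood polynomials `c₀ + c₁ z + ⋯ + c_{N-1} z^{N-1}` with every `c_j ∈ {1, -1}`. -/
def LittlewoodPoly (N : ℕ) : Set (Polynomial ℂ) :=
  {f | ∃ c : Fin N → ℂ, (∀ j, c j = 1 ∨ c j = -1) ∧
    f = ∑ j : Fin N, Polynomial.C (c j) * Polynomial.X ^ (j : ℕ)}

/-- `D_N(z) = 1 + z + ⋯ + z^{N-1}`. -/
noncomputable def dirichletPoly (N : ℕ) : Polynomial ℂ :=
  ∑ j ∈ Finset.range N, Polynomial.X ^ j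

/-- The function `θ ↦ (∑ₖ tₖ |fₖ(e^{iθ})|²)^{1/2}`. -/
noncomputable def squareFunction {K : ℕ} (t : Fin K → ℝ) (f : Fin K → Polynomial ℂ)
    (θ : ℝ) : ℝ :=
  Real.sqrt (∑ k, t k * ‖(f k).eval (Complex.exp (θ * Complex.I))‖ ^ 2)

/-- The `L_p(dθ)` (quasi-)norm `(∫_0^{2π} |g(θ)|^p dθ)^{1/p}`, for a real exponent `p > 0`,
with values in `[0, ∞]`. -/
noncomputable def circleLpNorm (p : ℝ) (g : ℝ → ℝ) : ENNReal :=
  eLpNorm g (ENNReal.ofReal p) (volume.restrict (Set.Ioc 0 (2 * Real.pi)))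

/-! Write E_f = ∑ t_k |f_k|² and q = p/2; the claim compares ∫ E_f^q with ∫ E_D^q. Everything
follows from one inequality, `integral_log_energy_dirichletPoly_le`: ∫ log(1 + s E_D) ≤ ∫ log(1 + s
E_f) for all s ≥ 0. For 0 < q < 1, x^q is a positive multiple of ∫ log(1 + s x) s^(-q-1) ds over s >
0. For 1 < q < 2 the kernel s x - log(1 + s x) plays this role and reverses the inequality, since ∫
E_f = ∫ E_D by Parseval. The case q = 1 is Parseval itself, and q = 2 is a limit.

For the logarithmic inequality, sample at the m-th roots of unity. The product of 1 + s E_f over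
them is the determinant of 1 + s ∑ t_k C_kᵀ C_k, where C_k is the circulant matrix of the
coefficients of f_k. By Cauchy–Binet this is a nonnegative combination of squared minors of the
identity stacked on the C_k. For D the rows are indicators of cyclic intervals. If none wraps
around, every minor is 0 or ±1; the corresponding minor for f has the same parity, so its square is
at least as large. The number of wrapping rows does not depend on m, and removing them costs a
factor bounded in m, which disappears after taking logarithms and dividing by m. -/

/-! ### Cauchy–Binet for weighted Gram matrices -/

/-- The matrix `∑ₘ wₘ uₘ uₘᵀ`. -/
def weightedGram {R M n : Type*} [CommRing R] [Fintype M] (w : M → R) (u : M → n → R) :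
    Matrix n n R :=
  Matrix.of fun i j => ∑ m, w m * u m i * u m j

/-- A form of the Cauchy–Binet formula, summed over all functions instead of subsets. -/
theorem factorial_mul_det_weightedGram {R M n : Type*} [CommRing R] [Fintype M] [Fintype n]
    [DecidableEq n] (w : M → R) (u : M → n → R) :
    ((Fintype.card n).factorial : R) * (weightedGram w u).det =
      ∑ g : n → M, (∏ i, w (g i)) * (Matrix.of fun i j => u (g i) j).det ^ 2 := by
  classical
  have h1 : (weightedGram w u).det =
      ∑ g : n → M, (∏ i, w (g i)) * (∏ i, u (g i) i) * (Matrix.of fun i j => u (g i) j).det := by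
    have hrow : weightedGram w u = fun i => ∑ m, (w m * u m i) • u m := by
      ext i j
      simp [weightedGram, Finset.sum_apply, mul_assoc]
    have := (Matrix.detRowAlternating (n := n) (R := R)).toMultilinearMap.map_sum
      (fun (i : n) (m : M) => (w m * u m i) • u m)
    rw [hrow]
    refine this.trans (Finset.sum_congr rfl fun g _ => ?_)
    have h2 := (Matrix.detRowAlternating (n := n) (R := R)).toMultilinearMap.map_smul_univ
      (fun i => w (g i) * u (g i) i) (fun i => u (g i))
    refine h2.trans ?_
    rw [Finset.prod_mul_distrib, smul_eq_mul]
    rfl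
  -- Reindexing g by g ∘ σ leaves the sum unchanged; summing over all σ then turns the product of
  -- the u (g i) i into a second copy of the determinant.
  have h2 : ∀ σ : Equiv.Perm n, (weightedGram w u).det =
      ∑ g : n → M, (∏ i, w (g i)) * (Matrix.of fun i j => u (g i) j).det *
        ((Equiv.Perm.sign σ : ℤ) * ∏ i, u (g (σ i)) i) := by
    intro σ
    rw [h1, ← (Equiv.arrowCongr σ.symm (Equiv.refl M)).sum_comp]
    refine Finset.sum_congr rfl fun g _ => ?_
    have hw : ∏ i, w (g (σ i)) = ∏ i, w (g i) := Equiv.prod_comp σ (fun i => w (g i))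
    have hd : (Matrix.of fun i j => u (g (σ i)) j).det =
        (Equiv.Perm.sign σ : ℤ) * (Matrix.of fun i j => u (g i) j).det := by
      rw [← Matrix.det_permute]; rfl
    simp only [Equiv.arrowCongr_apply, Equiv.coe_refl, Function.comp, Equiv.symm_symm, id]
    rw [hw, hd]
    ring
  have h3 : ((Fintype.card n).factorial : R) * (weightedGram w u).det =
      ∑ _σ : Equiv.Perm n, (weightedGram w u).det := by
    rw [Finset.sum_const, Finset.card_univ, Fintype.card_perm, nsmul_eq_mul]
  rw [h3, Finset.sum_congr rfl fun σ _ => h2 σ, Finset.sum_comm]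
  refine Finset.sum_congr rfl fun g _ => ?_
  rw [← Finset.mul_sum, mul_assoc, sq, Matrix.det_apply' (Matrix.of fun i j => u (g i) j)]
  rfl

/-! ### Interval matrices and reduction modulo 2 -/

/-- Square `0/1` matrices whose rows are indicators of intervals have determinant `0` or `±1`. -/
theorem det_interval_matrix_mem {n : ℕ} (s : Fin n → ℕ) (hs : Monotone s) (a b : Fin n → ℕ) :
    (Matrix.of fun i j => if a i ≤ s j ∧ s j < b i then (1 : ℤ) else 0).det ∈
      ({-1, 0, 1} : Set ℤ) := by
  induction n with
  | zero => simp
  | succ n ih =>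
    set A : Matrix (Fin (n + 1)) (Fin (n + 1)) ℤ :=
      Matrix.of fun i j => if a i ≤ s j ∧ s j < b i then (1 : ℤ) else 0 with hA
    have hA' : ∀ i j, A i j = if a i ≤ s j ∧ s j < b i then (1 : ℤ) else 0 := fun i j => rfl
    let S : Finset (Fin (n + 1)) := Finset.univ.filter fun i => a i ≤ s 0 ∧ s 0 < b i
    rcases S.eq_empty_or_nonempty with hS | hS
    · have : A.det = 0 := Matrix.det_eq_zero_of_column_eq_zero 0 fun i => by
        have : i ∉ S := by simp [hS]
        rw [hA', if_neg]
        simpa [S] using this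
      simp [this]
    -- Among the rows containing the first column, p ends earliest. Subtracting it from the others
    -- leaves the intervals [b p, b i), so the matrix stays an interval matrix and its first column
    -- becomes a unit vector.
    · obtain ⟨p, hp, hmin⟩ := S.exists_min_image b hS
      have hp' : a p ≤ s 0 ∧ s 0 < b p := by simpa [S] using hp
      let a' : Fin (n + 1) → ℕ := fun i => if i ∈ S ∧ i ≠ p then b p else a i
      let B : Matrix (Fin (n + 1)) (Fin (n + 1)) ℤ :=
        Matrix.of fun i j => if a' i ≤ s j ∧ s j < b i then (1 : ℤ) else 0
      have hAB : B.det = A.det := by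
        refine Matrix.det_eq_of_forall_row_eq_smul_add_const
          (fun i => if i ∈ S ∧ i ≠ p then -1 else 0) p (by simp) ?_
        intro i j
        have h0j : s 0 ≤ s j := hs (Fin.zero_le j)
        by_cases hi : i ∈ S ∧ i ≠ p
        · have hi' : a i ≤ s 0 ∧ s 0 < b i := by simpa [S] using hi.1
          have hb := hmin i hi.1
          simp only [B, Matrix.of_apply, a', if_pos hi, hA']
          split_ifs <;> omega
        · simp only [B, Matrix.of_apply, a', if_neg hi, hA']
          simp
      have hcol : ∀ i, i ≠ p → B i 0 = 0 := by
        intro i hi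
        simp only [B, Matrix.of_apply, a']
        rw [if_neg]
        by_cases hiS : i ∈ S
        · rw [if_pos ⟨hiS, hi⟩]; omega
        · rw [if_neg (by tauto)]
          simpa [S] using hiS
      have hpp : B p 0 = 1 := by
        simp only [B, Matrix.of_apply, a']
        simp [hp']
      have hdet : B.det = (-1) ^ (p : ℕ) * (B.submatrix p.succAbove Fin.succ).det := by
        rw [Matrix.det_succ_column_zero, Finset.sum_eq_single p]
        · rw [hpp, mul_one]
        · intro i _ hi
          rw [hcol i hi]; ring
        · simp
      have := ih (fun j => s j.succ) (fun i j h => hs (Fin.succ_le_succ_iff.mpr h))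
        (fun i => a' (p.succAbove i)) (fun i => b (p.succAbove i))
      have h2 : (B.submatrix p.succAbove Fin.succ).det ∈ ({-1, 0, 1} : Set ℤ) := this
      rw [← hAB, hdet]
      rcases neg_one_pow_eq_or ℤ (p : ℕ) with h | h <;> rw [h] <;>
        rcases h2 with h | h | h <;> rw [h] <;> simp

/-- Changing an interval matrix to another integer matrix with the same reduction modulo `2`
does not decrease the square of its determinant. -/
theorem sq_det_interval_le {n : ℕ} (U V : Matrix (Fin n) (Fin n) ℤ)
    (hU : ∀ i, ∃ a b : ℕ, ∀ j, U i j = if a ≤ (j : ℕ) ∧ (j : ℕ) < b then 1 else 0)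
    (hUV : ∀ i j, (U i j : ZMod 2) = V i j) : U.det ^ 2 ≤ V.det ^ 2 := by
  choose a b hab using hU
  have hU' : U = Matrix.of fun i j => if a i ≤ ((j : Fin n) : ℕ) ∧ (j : ℕ) < b i then (1 : ℤ) else 0 := by
    ext i j; exact hab i j
  have h := det_interval_matrix_mem (fun j : Fin n => (j : ℕ)) (fun _ _ h => h) a b
  rw [← hU'] at h
  -- The determinants have equal parity: if U.det is ±1, then V.det is odd, hence nonzero.
  have hmod : ((U.det : ℤ) : ZMod 2) = (V.det : ℤ) := by
    have e : ∀ W : Matrix (Fin n) (Fin n) ℤ, ((W.det : ℤ) : ZMod 2) =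
        (W.map (Int.castRingHom (ZMod 2))).det := fun W => (Int.castRingHom (ZMod 2)).map_det W
    rw [e, e]
    congr 1
    ext i j
    exact hUV i j
  have hV : U.det = 0 ∨ (U.det ^ 2 = 1 ∧ V.det ≠ 0) := by
    rcases h with h | h | h
    · right
      refine ⟨by rw [h]; norm_num, fun h0 => ?_⟩
      rw [h, h0] at hmod
      revert hmod; decide
    · exact Or.inl h
    · right
      refine ⟨by rw [h]; norm_num, fun h0 => ?_⟩
      rw [h, h0] at hmod
      revert hmod; decide
  rcases hV with h | ⟨h, h'⟩
  · rw [h]; positivity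
  · rw [h]
    have := sq_pos_of_ne_zero h' 
    omega

/-- Among integer vectors with prescribed reductions modulo `2`, interval indicators minimize the
determinant of a weighted Gram matrix. -/
theorem det_weightedGram_interval_le {n : ℕ} {M : Type*} [Fintype M] (w : M → ℝ)
    (hw : ∀ m, 0 ≤ w m) (u v : M → Fin n → ℤ)
    (hu : ∀ m, w m ≠ 0 → ∃ a b : ℕ, ∀ j, u m j = if a ≤ (j : ℕ) ∧ (j : ℕ) < b then 1 else 0)
    (huv : ∀ m j, (u m j : ZMod 2) = v m j) :
    (weightedGram w fun m j => (u m j : ℝ)).det ≤ (weightedGram w fun m j => (v m j : ℝ)).det := by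
  have hpos : (0 : ℝ) < ((Fintype.card (Fin n)).factorial : ℝ) := by positivity
  refine le_of_mul_le_mul_left ?_ hpos
  rw [factorial_mul_det_weightedGram, factorial_mul_det_weightedGram]
  refine Finset.sum_le_sum fun g _ => ?_
  by_cases h0 : ∃ i, w (g i) = 0
  · obtain ⟨i, hi⟩ := h0
    rw [Finset.prod_eq_zero (Finset.mem_univ i) hi]
    simp
  · push Not at h0
    refine mul_le_mul_of_nonneg_left ?_ (Finset.prod_nonneg fun i _ => hw _)
    have e : ∀ x : M → Fin n → ℤ, (Matrix.of fun i j => (x (g i) j : ℝ)).det =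
        ((Matrix.of fun i j => x (g i) j).det : ℤ) := fun x =>
      ((Int.castRingHom ℝ).map_det (Matrix.of fun i j => x (g i) j)).symm
    rw [e, e]
    exact_mod_cast sq_det_interval_le (Matrix.of fun i j => u (g i) j)
      (Matrix.of fun i j => v (g i) j) (fun i => hu _ (h0 i)) (fun i j => huv _ _)

/-! ### Determinants of 1 plus a Gram matrix: cost of removing rows -/

open Matrix in
theorem weightedGram_posSemidef {M n : Type*} [Fintype M] [Fintype n] (w : M → ℝ)
    (hw : ∀ m, 0 ≤ w m) (u : M → n → ℝ) : (weightedGram w u).PosSemidef := by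
  have h : weightedGram w u = ∑ m, w m • vecMulVec (u m) (star (u m)) := by
    ext i j
    simp [weightedGram, Matrix.sum_apply, vecMulVec_apply, mul_assoc]
  rw [h]
  exact posSemidef_sum _ fun m _ => (posSemidef_vecMulVec_self_star (u m)).smul (hw m)

-- The matrix determinant lemma gives the exact factor 1 + c v·X⁻¹v, and X ≥ 1 forces v·X⁻¹v ≤ v·v.
open Matrix in
theorem det_add_smul_vecMulVec_le {n : Type*} [Fintype n] [DecidableEq n] (X : Matrix n n ℝ)
    (hX : (X - 1).PosSemidef) (c : ℝ) (hc : 0 ≤ c) (v : n → ℝ) :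
    (X + c • vecMulVec v v).det ≤ X.det * (1 + c * (v ⬝ᵥ v)) := by
  have hXpd : X.PosDef := by
    have := PosDef.one.add_posSemidef hX
    simpa using this
  have hdet := hXpd.det_pos
  have hu : IsUnit X.det := hdet.ne'.isUnit
  set y := X⁻¹ *ᵥ v with hy
  have hXy : X *ᵥ y = v := by
    rw [hy, mulVec_mulVec, mul_nonsing_inv _ hu, one_mulVec]
  have h1 : (X + c • vecMulVec v v).det = X.det * (1 + c * (v ⬝ᵥ y)) := by
    have e : c • vecMulVec v v = replicateCol Unit (c • v) * replicateRow Unit v := by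
      rw [← vecMulVec_eq, smul_vecMulVec]
    rw [e, det_add_replicateCol_mul_replicateRow hu]
    congr 1
    rw [det_unique, Matrix.add_apply, one_apply_eq, Matrix.mul_assoc, ← replicateCol_mulVec,
      mulVec_smul, ← hy]
    simp [mul_apply, dotProduct, Finset.mul_sum, mul_left_comm]
  have hyy : y ⬝ᵥ y ≤ v ⬝ᵥ y := by
    have := hX.dotProduct_mulVec_nonneg y
    rw [sub_mulVec, one_mulVec, hXy, dotProduct_sub] at this
    simp only [star_trivial] at this
    rw [dotProduct_comm v y]; linarith
  -- From |v - y|² ≥ 0, v·v ≥ 2 v·y - y·y, which is at least v·y by `hyy`.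
  have hvy : v ⬝ᵥ y ≤ v ⬝ᵥ v := by
    have h0 : 0 ≤ (v - y) ⬝ᵥ (v - y) := by
      simpa using dotProduct_star_self_nonneg (v - y)
    rw [sub_dotProduct, dotProduct_sub, dotProduct_sub, dotProduct_comm y v] at h0
    linarith
  rw [h1]
  gcongr

open Matrix in
theorem det_one_add_weightedGram_le_mul_prod {M n : Type*} [Fintype M] [Fintype n]
    [DecidableEq n] [DecidableEq M] (w : M → ℝ) (hw : ∀ m, 0 ≤ w m) (u : M → n → ℝ)
    (S : Finset M) :
    (1 + weightedGram w u).det ≤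
      (1 + weightedGram (fun m => if m ∈ S then 0 else w m) u).det *
        ∏ m ∈ S, (1 + w m * (u m ⬝ᵥ u m)) := by
  induction S using Finset.induction_on with
  | empty => simp
  | insert a S ha ih =>
    refine ih.trans ?_
    rw [Finset.prod_insert ha, ← mul_assoc]
    refine mul_le_mul_of_nonneg_right ?_ (Finset.prod_nonneg fun m _ =>
      add_nonneg zero_le_one (mul_nonneg (hw m) (by simpa using dotProduct_star_self_nonneg (u m))))
    have e : (1 + weightedGram (fun m => if m ∈ S then 0 else w m) u) =
        (1 + weightedGram (fun m => if m ∈ insert a S then 0 else w m) u) +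
          w a • vecMulVec (u a) (u a) := by
      rw [add_assoc]
      congr 1
      ext i j
      simp only [weightedGram, Matrix.add_apply, Matrix.of_apply, Matrix.smul_apply,
        vecMulVec_apply, smul_eq_mul]
      rw [← Finset.add_sum_erase _ _ (Finset.mem_univ a),
        ← Finset.add_sum_erase (a := a) _ (fun m => (if m ∈ insert a S then 0 else w m) * u m i * u m j)
          (Finset.mem_univ a), if_neg ha, if_pos (Finset.mem_insert_self a S)]
      have : ∀ m ∈ Finset.univ.erase a, (if m ∈ S then 0 else w m) * u m i * u m j =
          (if m ∈ insert a S then 0 else w m) * u m i * u m j := by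
        intro m hm
        have : m ≠ a := Finset.ne_of_mem_erase hm
        simp [this]
      rw [Finset.sum_congr rfl this]
      ring
    rw [e]
    refine det_add_smul_vecMulVec_le _ ?_ _ (hw a) _
    rw [add_sub_cancel_left]
    exact weightedGram_posSemidef _ (fun m => by split_ifs <;> [exact le_rfl; exact hw m]) u

/-- The summand 1 is absorbed as extra rows of weight 1, so that Cauchy–Binet applies; these unit
rows are themselves interval indicators [i, i+1). -/
theorem weightedGram_sum_single {R M n : Type*} [CommRing R] [Fintype M] [Fintype n]
    [DecidableEq n] (w : M → R) (u : M → n → R) :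
    weightedGram (Sum.elim (fun _ : n => 1) w) (Sum.elim (fun i => Pi.single i 1) u) =
      1 + weightedGram w u := by
  ext i j
  simp [weightedGram, Matrix.one_apply, Pi.single_apply]

theorem det_weightedGram_mono {M n : Type*} [Fintype M] [Fintype n] [DecidableEq n]
    (w w' : M → ℝ) (hw : ∀ m, 0 ≤ w m) (hww' : ∀ m, w m ≤ w' m) (u : M → n → ℝ) :
    (weightedGram w u).det ≤ (weightedGram w' u).det := by
  have hpos : (0 : ℝ) < ((Fintype.card n).factorial : ℝ) := by positivity
  refine le_of_mul_le_mul_left ?_ hpos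
  rw [factorial_mul_det_weightedGram, factorial_mul_det_weightedGram]
  refine Finset.sum_le_sum fun g _ => mul_le_mul_of_nonneg_right ?_ (sq_nonneg _)
  exact Finset.prod_le_prod (fun i _ => hw _) fun i _ => hww' _

theorem det_one_add_weightedGram_mono {M n : Type*} [Fintype M] [Fintype n] [DecidableEq n]
    (w w' : M → ℝ) (hw : ∀ m, 0 ≤ w m) (hww' : ∀ m, w m ≤ w' m) (u : M → n → ℝ) :
    (1 + weightedGram w u).det ≤ (1 + weightedGram w' u).det := by
  rw [← weightedGram_sum_single, ← weightedGram_sum_single]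
  refine det_weightedGram_mono _ _ ?_ ?_ _
  · rintro (i | m)
    · exact zero_le_one
    · exact hw m
  · rintro (i | m)
    · exact le_rfl
    · exact hww' m

theorem det_one_add_weightedGram_interval_le {n : ℕ} {M : Type*} [Fintype M] (w : M → ℝ)
    (hw : ∀ m, 0 ≤ w m) (u v : M → Fin n → ℤ)
    (hu : ∀ m, w m ≠ 0 → ∃ a b : ℕ, ∀ j, u m j = if a ≤ (j : ℕ) ∧ (j : ℕ) < b then 1 else 0)
    (huv : ∀ m j, (u m j : ZMod 2) = v m j) :
    (1 + weightedGram w fun m j => (u m j : ℝ)).det ≤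
      (1 + weightedGram w fun m j => (v m j : ℝ)).det := by
  have e : ∀ x : M → Fin n → ℤ, (Sum.elim (fun i => Pi.single i 1) fun m j => (x m j : ℝ)) =
      fun (m : Fin n ⊕ M) j => ((Sum.elim (fun i => Pi.single i 1) x m j : ℤ) : ℝ) := by
    intro x
    funext m j
    rcases m with i | m
    · simp [Pi.single_apply]
    · rfl
  rw [← weightedGram_sum_single, ← weightedGram_sum_single, e, e]
  refine det_weightedGram_interval_le _ ?_ _ _ ?_ ?_
  · rintro (i | m)
    · exact zero_le_one
    · exact hw m
  · rintro (i | m) h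
    · refine ⟨i, i + 1, fun j => ?_⟩
      simp only [Sum.elim_inl, Pi.single_apply]
      congr 1
      rw [Fin.ext_iff, eq_iff_iff]
      omega
    · exact hu m h
  · rintro (i | m) j
    · rfl
    · exact huv m j

open Matrix in
/-- If all but the rows in `S` of `u` are interval indicators, then the conclusion of
`det_one_add_weightedGram_interval_le` holds up to a factor depending only on these rows. -/
theorem det_one_add_weightedGram_almost_interval_le {n : ℕ} {M : Type*} [Fintype M]
    [DecidableEq M] (w : M → ℝ) (hw : ∀ m, 0 ≤ w m) (u v : M → Fin n → ℤ) (S : Finset M)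
    (hu : ∀ m, m ∉ S → ∃ a b : ℕ, ∀ j, u m j = if a ≤ (j : ℕ) ∧ (j : ℕ) < b then 1 else 0)
    (huv : ∀ m j, (u m j : ZMod 2) = v m j) :
    (1 + weightedGram w fun m j => (u m j : ℝ)).det ≤
      (1 + weightedGram w fun m j => (v m j : ℝ)).det *
        ∏ m ∈ S, (1 + w m * ((fun j => (u m j : ℝ)) ⬝ᵥ (fun j => (u m j : ℝ)))) := by
  have hw' : ∀ m, 0 ≤ if m ∈ S then 0 else w m := fun m => by
    split_ifs <;> [exact le_rfl; exact hw m]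
  refine (det_one_add_weightedGram_le_mul_prod w hw _ S).trans ?_
  refine mul_le_mul_of_nonneg_right ?_ (Finset.prod_nonneg fun m _ => add_nonneg zero_le_one
    (mul_nonneg (hw m) (by simpa using dotProduct_star_self_nonneg (fun j => (u m j : ℝ)))))
  refine (det_one_add_weightedGram_interval_le _ hw' u v ?_ huv).trans
    (det_one_add_weightedGram_mono _ _ hw' ?_ _)
  · intro m hm
    exact hu m fun h => hm (if_pos h)
  · intro m
    split_ifs <;> [exact hw m; exact le_rfl]

/-! ### Circulant determinants and sampling at roots of unity -/

/-- The additive characters of ZMod m are common eigenvectors of all circulant matrices; the factors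
on the right are the eigenvalues. -/
theorem det_one_add_weightedGram_circulant {K m : ℕ} [NeZero m] (w : Fin K → ℝ)
    (a : Fin K → ZMod m → ℝ) :
    (1 + weightedGram (fun p : Fin K × ZMod m => w p.1) (fun p j => a p.1 (p.2 - j))).det =
      ∏ l : ZMod m, (1 + ∑ k, w k * ‖∑ x, (a k x : ℂ) * ZMod.stdAddChar (x * l)‖ ^ 2) := by
  set χ := ZMod.stdAddChar (N := m) with hχ
  set A : Fin K → ZMod m → ℂ := fun k l => ∑ x, (a k x : ℂ) * χ (x * l) with hA
  let Φ : Matrix (ZMod m) (ZMod m) ℂ := Matrix.of fun i l => χ (i * l)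
  let Ψ : Matrix (ZMod m) (ZMod m) ℂ := Matrix.of fun l i => χ (-(i * l))
  set G := 1 + weightedGram (fun p : Fin K × ZMod m => w p.1) (fun p j => a p.1 (p.2 - j)) with hG
  set d : ZMod m → ℝ := fun l => 1 + ∑ k, w k * ‖A k l‖ ^ 2 with hd
  -- Orthogonality of characters, needed only to make Φ invertible.
  have hΦΨ : Φ * Ψ = (m : ℂ) • (1 : Matrix (ZMod m) (ZMod m) ℂ) := by
    ext i j
    have := AddChar.sum_mulShift (i - j) (ZMod.isPrimitive_stdAddChar m)
    simp only [Matrix.mul_apply, Matrix.smul_apply, Matrix.one_apply, Φ, Ψ, Matrix.of_apply]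
    rw [Finset.sum_congr rfl fun x _ => show χ (i * x) * χ (-(j * x)) = χ (x * (i - j)) by
      rw [← AddChar.map_add_eq_mul]; congr 1; ring]
    rw [this, ZMod.card]
    simp [sub_eq_zero]
  have hΦ : Φ.det ≠ 0 := by
    intro h0
    have := congrArg Matrix.det hΦΨ
    rw [Matrix.det_mul, h0, zero_mul, Matrix.det_smul, Matrix.det_one, mul_one] at this
    exact pow_ne_zero _ (Nat.cast_ne_zero.mpr (NeZero.ne m)) this.symm
  have hconj : ∀ x, χ (-x) = (starRingEnd ℂ) (χ x) := fun x => AddChar.map_neg_eq_conj χ x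
  have h1 : ∀ k r l, ∑ j, (a k (r - j) : ℂ) * χ (j * l) = χ (r * l) * (starRingEnd ℂ) (A k l) := by
    intro k r l
    rw [← (Equiv.subLeft r).sum_comp, hA, map_sum, Finset.mul_sum]
    refine Finset.sum_congr rfl fun x _ => ?_
    rw [map_mul (starRingEnd ℂ), Complex.conj_ofReal, ← hconj, Equiv.subLeft_apply, sub_sub_cancel,
      sub_mul, sub_eq_add_neg, AddChar.map_add_eq_mul]
    ring
  have h2 : ∀ k i l, ∑ r, (a k (r - i) : ℂ) * χ (r * l) = χ (i * l) * A k l := by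
    intro k i l
    rw [← Equiv.sum_comp (Equiv.addRight i), hA, Finset.mul_sum]
    refine Finset.sum_congr rfl fun x _ => ?_
    rw [Equiv.coe_addRight, add_sub_cancel_right, add_mul, AddChar.map_add_eq_mul]
    ring
  have hmul : (G.map (algebraMap ℝ ℂ)) * Φ = Φ * Matrix.diagonal (fun l => (d l : ℂ)) := by
    ext i l
    rw [Matrix.mul_diagonal, Matrix.mul_apply]
    have e : ∀ j, (G.map (algebraMap ℝ ℂ)) i j * Φ j l = (1 : Matrix _ _ ℂ) i j * χ (j * l) +
        ∑ k, ∑ r, (w k : ℂ) * a k (r - i) * ((a k (r - j) : ℂ) * χ (j * l)) := by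
      intro j
      simp only [hG, Matrix.map_apply, Matrix.add_apply, weightedGram, Matrix.of_apply, map_add,
        map_sum, map_mul, Φ, add_mul, Fintype.sum_prod_type, Finset.sum_mul, mul_assoc]
      congr 1
      simp [Matrix.one_apply]
    rw [Finset.sum_congr rfl fun j _ => e j, Finset.sum_add_distrib, Finset.sum_comm]
    have e2 : ∀ k, ∑ j, ∑ r, (w k : ℂ) * a k (r - i) * ((a k (r - j) : ℂ) * χ (j * l)) =
        χ (i * l) * (w k * ‖A k l‖ ^ 2 : ℝ) := by
      intro k
      rw [Finset.sum_comm]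
      simp_rw [← Finset.mul_sum, h1]
      rw [Finset.sum_congr rfl fun r _ => show (w k : ℂ) * a k (r - i) *
        (χ (r * l) * (starRingEnd ℂ) (A k l)) = (w k * (starRingEnd ℂ) (A k l)) *
          (a k (r - i) * χ (r * l)) by ring, ← Finset.mul_sum, h2]
      have : (A k l) * (starRingEnd ℂ) (A k l) = (‖A k l‖ : ℂ) ^ 2 := Complex.mul_conj' _
      push_cast
      rw [← this]; ring
    rw [Finset.sum_congr rfl fun k _ => e2 k]
    simp [Matrix.one_apply, hd, Φ, mul_add, Finset.mul_sum]
  have hdet := congrArg Matrix.det hmul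
  rw [Matrix.det_mul, Matrix.det_mul, mul_comm, Matrix.det_diagonal] at hdet
  have h3 := mul_left_cancel₀ hΦ hdet
  have h4 : (G.map (algebraMap ℝ ℂ)).det = (G.det : ℂ) := ((algebraMap ℝ ℂ).map_det G).symm
  rw [h4] at h3
  exact_mod_cast h3

theorem stdAddChar_eq_exp {m : ℕ} [NeZero m] (l : ZMod m) :
    ZMod.stdAddChar l = Complex.exp ((2 * Real.pi * l.val / m : ℝ) * Complex.I) := by
  rw [ZMod.stdAddChar_apply, ZMod.toCircle_apply]
  push_cast
  congr 1
  ring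

theorem ZMod.sum_val {R : Type*} [AddCommMonoid R] {m : ℕ} [NeZero m] (g : ℕ → R) :
    ∑ x : ZMod m, g x.val = ∑ j ∈ Finset.range m, g j := by
  obtain ⟨q, rfl⟩ := Nat.exists_eq_succ_of_ne_zero (NeZero.ne m)
  exact Fin.sum_univ_eq_sum_range g (q + 1)

/-- `c` lists the coefficients `±1` of `f`, continued by zeros. -/
structure IsSignCoeff (N : ℕ) (c : ℕ → ℤ) (f : Polynomial ℂ) : Prop where
  sign : ∀ j, j < N → c j = 1 ∨ c j = -1
  zero : ∀ j, N ≤ j → c j = 0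
  eq_sum : f = ∑ j ∈ Finset.range N, Polynomial.C (c j : ℂ) * Polynomial.X ^ j

theorem exists_isSignCoeff {N : ℕ} {f : Polynomial ℂ} (hf : f ∈ LittlewoodPoly N) :
    ∃ c, IsSignCoeff N c f := by
  obtain ⟨c, hc, rfl⟩ := hf
  have : ∀ j : Fin N, ∃ z : ℤ, (z = 1 ∨ z = -1) ∧ (z : ℂ) = c j := by
    intro j
    rcases hc j with h | h
    · exact ⟨1, Or.inl rfl, by simp [h]⟩
    · exact ⟨-1, Or.inr rfl, by simp [h]⟩
  choose z hz hzc using this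
  refine ⟨fun j => if h : j < N then z ⟨j, h⟩ else 0, ⟨?_, ?_, ?_⟩⟩
  · intro j hj
    simpa [hj] using hz ⟨j, hj⟩
  · intro j hj
    simp [hj.not_gt]
  · rw [← Fin.sum_univ_eq_sum_range (fun j => Polynomial.C
      (((if h : j < N then z ⟨j, h⟩ else 0 : ℤ)) : ℂ) * Polynomial.X ^ j)]
    refine Finset.sum_congr rfl fun j _ => ?_
    simp [hzc]

theorem isSignCoeff_dirichletPoly (N : ℕ) :
    IsSignCoeff N (fun j => if j < N then 1 else 0) (dirichletPoly N) := by
  refine ⟨fun j hj => by simp [hj], fun j hj => by simp [hj.not_gt], ?_⟩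
  refine Finset.sum_congr rfl fun j hj => ?_
  simp [Finset.mem_range.mp hj]

theorem IsSignCoeff.eval_exp {N : ℕ} {c : ℕ → ℤ} {f : Polynomial ℂ} (h : IsSignCoeff N c f)
    {m : ℕ} [NeZero m] (hm : N ≤ m) (l : ZMod m) :
    f.eval (Complex.exp ((2 * Real.pi * l.val / m : ℝ) * Complex.I)) =
      ∑ x : ZMod m, (((c x.val : ℤ) : ℝ) : ℂ) * ZMod.stdAddChar (x * l) := by
  have e : ∀ x : ZMod m, (((c x.val : ℤ) : ℝ) : ℂ) * ZMod.stdAddChar (x * l) =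
      (c x.val : ℂ) * (ZMod.stdAddChar l) ^ x.val := by
    intro x
    rw [← AddChar.map_nsmul_eq_pow, nsmul_eq_mul, ZMod.natCast_zmod_val]
    simp
  rw [Finset.sum_congr rfl fun x _ => e x,
    ZMod.sum_val (fun j => (c j : ℂ) * (ZMod.stdAddChar l) ^ j), ← stdAddChar_eq_exp, h.eq_sum,
    Polynomial.eval_finsetSum]
  simp only [Polynomial.eval_mul, Polynomial.eval_C, Polynomial.eval_pow, Polynomial.eval_X]
  refine Finset.sum_subset (Finset.range_subset_range.mpr hm) fun j _ hj => ?_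
  rw [h.zero j (by simpa using hj)]
  simp

/-- The square of the square function. -/
noncomputable def energy {K : ℕ} (t : Fin K → ℝ) (f : Fin K → Polynomial ℂ) (θ : ℝ) : ℝ :=
  ∑ k, t k * ‖(f k).eval (Complex.exp (θ * Complex.I))‖ ^ 2

theorem det_one_add_weightedGram_eq_prod_energy {K m : ℕ} [NeZero m] {N : Fin K → ℕ}
    {c : Fin K → ℕ → ℤ} {f : Fin K → Polynomial ℂ} (h : ∀ k, IsSignCoeff (N k) (c k) (f k))
    (hm : ∀ k, N k ≤ m) (t : Fin K → ℝ) (s : ℝ) :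
    (1 + weightedGram (fun p : Fin K × ZMod m => s * t p.1)
      (fun p j => ((c p.1 (p.2 - j).val : ℤ) : ℝ))).det =
      ∏ l ∈ Finset.range m, (1 + s * energy t f (2 * Real.pi * l / m)) := by
  have := det_one_add_weightedGram_circulant (fun k => s * t k)
    (fun k (x : ZMod m) => ((c k x.val : ℤ) : ℝ))
  refine this.trans ?_
  obtain ⟨q, rfl⟩ := Nat.exists_eq_succ_of_ne_zero (NeZero.ne m)
  rw [← Fin.prod_univ_eq_prod_range
    (fun l => 1 + s * energy t f (2 * Real.pi * (l : ℕ) / (q + 1 : ℕ)))]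
  refine Finset.prod_congr rfl fun l _ => ?_
  rw [energy, Finset.mul_sum]
  congr 1
  refine Finset.sum_congr rfl fun k _ => ?_
  rw [← (h k).eval_exp (hm k) l, mul_assoc]
  rfl

theorem energy_nonneg {K : ℕ} {t : Fin K → ℝ} (ht : ∀ k, 0 ≤ t k) (f : Fin K → Polynomial ℂ)
    (θ : ℝ) : 0 ≤ energy t f θ :=
  Finset.sum_nonneg fun k _ => mul_nonneg (ht k) (sq_nonneg _)

/-- Row r of the circulant is supported on the N cyclic positions ending at r; the hypothesis on r
says that they do not wrap past 0. -/
theorem isInterval_shift {N q : ℕ} (r : ZMod (q + 1)) (hr : N ≤ r.val + 1) :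
    ∃ a b : ℕ, ∀ j : ZMod (q + 1), (if (r - j).val < N then (1 : ℤ) else 0) =
      if a ≤ j.val ∧ j.val < b then 1 else 0 := by
  refine ⟨r.val + 1 - N, r.val + 1, fun j => ?_⟩
  have hrv : r.val < q + 1 := ZMod.val_lt r
  have hjl : j.val < q + 1 := ZMod.val_lt j
  congr 1
  rw [eq_iff_iff]
  by_cases hle : j.val ≤ r.val
  · rw [ZMod.val_sub hle]
    omega
  · have : (r - j).val = q + 1 + r.val - j.val := by
      have h2 : r - j = ((q + 1 + r.val - j.val : ℕ) : ZMod (q + 1)) := by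
        rw [Nat.cast_sub (by omega), Nat.cast_add, ZMod.natCast_self, zero_add,
          ZMod.natCast_zmod_val, ZMod.natCast_zmod_val]
      rw [h2, ZMod.val_natCast, Nat.mod_eq_of_lt (by omega)]
    rw [this]
    omega

theorem sum_shift_sq {N q : ℕ} (hN : N ≤ q + 1) (r : ZMod (q + 1)) :
    ∑ j : ZMod (q + 1), (if (r - j).val < N then (1 : ℝ) else 0) * (if (r - j).val < N then 1 else 0)
      = N := by
  rw [← Equiv.sum_comp (Equiv.subLeft r)]
  simp only [Equiv.subLeft_apply, sub_sub_cancel]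
  rw [ZMod.sum_val (fun j => (if j < N then (1 : ℝ) else 0) * (if j < N then 1 else 0))]
  simp only [mul_ite, mul_one, mul_zero, ← ite_and, and_self]
  rw [← Finset.sum_filter, Finset.sum_const, nsmul_eq_mul, mul_one]
  congr 1
  rw [show (Finset.range (q + 1)).filter (· < N) = Finset.range N by ext; simp; omega,
    Finset.card_range]

theorem card_filter_val_le (N q : ℕ) :
    (Finset.univ.filter fun r : ZMod (q + 1) => r.val + 1 < N).card ≤ N := by
  calc _ ≤ (Finset.range N).card := Finset.card_le_card_of_injOn ZMod.val
        (fun r hr => by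
          have : r.val + 1 < N := by simpa using hr
          simp only [Finset.coe_range, Set.mem_Iio]; omega)
        (ZMod.val_injective _).injOn
    _ = N := Finset.card_range N

open Matrix in
theorem prod_energy_dirichletPoly_le {K q : ℕ} {N : Fin K → ℕ}
    {c : Fin K → ℕ → ℤ} {f : Fin K → Polynomial ℂ} (h : ∀ k, IsSignCoeff (N k) (c k) (f k))
    (hm : ∀ k, N k ≤ q + 1) (t : Fin K → ℝ) (ht : ∀ k, 0 ≤ t k) (s : ℝ) (hs : 0 ≤ s) :
    ∏ l ∈ Finset.range (q + 1),
        (1 + s * energy t (fun k => dirichletPoly (N k)) (2 * Real.pi * l / (q + 1 : ℕ))) ≤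
      (∏ l ∈ Finset.range (q + 1), (1 + s * energy t f (2 * Real.pi * l / (q + 1 : ℕ)))) *
        ∏ k, (1 + s * t k * N k) ^ N k := by
  let S : Finset (Fin K × ZMod (q + 1)) := Finset.univ.filter fun p => p.2.val + 1 < N p.1
  let u : Fin K × ZMod (q + 1) → ZMod (q + 1) → ℤ := fun p j =>
    if (p.2 - j).val < N p.1 then 1 else 0
  let v : Fin K × ZMod (q + 1) → ZMod (q + 1) → ℤ := fun p j => c p.1 (p.2 - j).val
  have hw : ∀ p : Fin K × ZMod (q + 1), 0 ≤ s * t p.1 := fun p => mul_nonneg hs (ht _)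
  -- S collects the wrapping rows, at most N k for each k whatever q is. `ZMod (q + 1)` unfolds to
  -- `Fin (q + 1)`, which supplies the order of the columns.
  have key := det_one_add_weightedGram_almost_interval_le (fun p => s * t p.1) hw u v S ?_ ?_
  · have hu := det_one_add_weightedGram_eq_prod_energy (m := q + 1)
      (fun k => isSignCoeff_dirichletPoly (N k)) hm t s
    have hv := det_one_add_weightedGram_eq_prod_energy (m := q + 1) h hm t s
    have hnonneg : 0 ≤ ∏ l ∈ Finset.range (q + 1),
        (1 + s * energy t f (2 * Real.pi * l / (q + 1 : ℕ))) :=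
      Finset.prod_nonneg fun l _ => add_nonneg zero_le_one (mul_nonneg hs (energy_nonneg ht f _))
    have hrow : ∀ p : Fin K × ZMod (q + 1),
        (fun j => (u p j : ℝ)) ⬝ᵥ (fun j => (u p j : ℝ)) = N p.1 := by
      intro p
      rw [← sum_shift_sq (hm p.1) p.2]
      refine Finset.sum_congr rfl fun j _ => ?_
      simp [u]
    rw [← hu]
    refine key.trans (mul_le_mul hv.le ((Finset.prod_congr rfl fun p _ =>
      congrArg (fun x => 1 + s * t p.1 * x) (hrow p)).trans_le ?_) (Finset.prod_nonneg fun p _ =>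
        add_nonneg zero_le_one (mul_nonneg (hw p)
          ((Nat.cast_nonneg (N p.1)).trans_eq (hrow p).symm))) hnonneg)
    calc _ = ∏ k, (1 + s * t k * N k) ^
            (Finset.univ.filter fun r : ZMod (q + 1) => r.val + 1 < N k).card := by
          rw [Finset.prod_filter, Fintype.prod_prod_type]
          refine Finset.prod_congr rfl fun k _ => ?_
          exact (Finset.prod_filter _ _).symm.trans (Finset.prod_const (1 + s * t k * N k))
      _ ≤ _ := by
          have h1 : ∀ k, 1 ≤ 1 + s * t k * N k := fun k =>
            le_add_of_nonneg_right (mul_nonneg (mul_nonneg hs (ht k)) (Nat.cast_nonneg _))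
          refine Finset.prod_le_prod (fun k _ => by have := h1 k; positivity) fun k _ => ?_
          exact pow_le_pow_right₀ (h1 k) (card_filter_val_le _ _)
  · intro p hp
    exact isInterval_shift p.2 (by simpa [S] using hp)
  · intro p j
    simp only [u, v]
    split_ifs with hlt
    · rcases (h p.1).sign _ hlt with e | e
      · rw [e]
      · rw [e]; rfl
    · rw [(h p.1).zero _ (not_lt.mp hlt)]

/-! ### Riemann sums and the logarithmic inequality -/

open Filter Topology in
theorem tendsto_riemann_sum {L : ℝ} (hL : 0 ≤ L) {g : ℝ → ℝ} (hg : Continuous g) :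
    Tendsto (fun q : ℕ => L / (q + 1 : ℕ) * ∑ l ∈ Finset.range (q + 1), g (L * l / (q + 1 : ℕ)))
      atTop (𝓝 (∫ x in 0..L, g x)) := by
  rw [Metric.tendsto_atTop]
  intro ε hε
  have huc := (isCompact_Icc (a := (0 : ℝ)) (b := L)).uniformContinuousOn_of_continuous hg.continuousOn
  rw [Metric.uniformContinuousOn_iff] at huc
  -- Dividing by L + 1 instead of L allows L = 0 and makes the final bound strict.
  obtain ⟨δ, hδ, hδg⟩ := huc (ε / (L + 1)) (by positivity)
  obtain ⟨Q, hQ⟩ := exists_nat_gt (L / δ)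
  refine ⟨Q, fun q hq => ?_⟩
  have hm : (0 : ℝ) < (q + 1 : ℕ) := by positivity
  set m : ℝ := ((q + 1 : ℕ) : ℝ) with hmdef
  have hmesh : L / m < δ := by
    have : L / δ < m := by
      have : (Q : ℝ) ≤ q := by exact_mod_cast hq
      rw [hmdef]; push_cast; linarith
    rw [div_lt_iff₀ hδ] at this
    rw [div_lt_iff₀ hm]; linarith
  let a : ℕ → ℝ := fun l => L * l / m
  have hstep : ∀ l, a (l + 1) - a l = L / m := fun l => by simp only [a]; push_cast; ring
  have hsum : ∫ x in 0..L, g x = ∑ l ∈ Finset.range (q + 1), ∫ x in a l..a (l + 1), g x := by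
    rw [intervalIntegral.sum_integral_adjacent_intervals fun k _ => hg.intervalIntegrable _ _]
    have h0 : a 0 = 0 := by simp [a]
    have h1 : a (q + 1) = L := by
      simp only [a, ← hmdef]
      field_simp
    rw [h0, h1]
  have hconst : L / m * ∑ l ∈ Finset.range (q + 1), g (a l) =
      ∑ l ∈ Finset.range (q + 1), ∫ x in a l..a (l + 1), g (a l) := by
    rw [Finset.mul_sum]
    refine Finset.sum_congr rfl fun l _ => ?_
    rw [intervalIntegral.integral_const, hstep, smul_eq_mul]
  rw [Real.dist_eq, hsum]
  change |L / m * ∑ l ∈ Finset.range (q + 1), g (a l) - _| < ε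
  rw [hconst, ← Finset.sum_sub_distrib]
  have hLm : 0 ≤ L / m := by positivity
  have hbound : ∀ l ∈ Finset.range (q + 1),
      |(∫ x in a l..a (l + 1), g (a l)) - ∫ x in a l..a (l + 1), g x| ≤ ε / (L + 1) * (L / m) := by
    intro l hl
    have hal : a l ≤ a (l + 1) := by linarith [hstep l]
    have ha0 : 0 ≤ a l := by positivity
    have ha1 : a (l + 1) ≤ L := by
      have hl' : ((l + 1 : ℕ) : ℝ) ≤ m := by
        rw [hmdef]; exact_mod_cast Finset.mem_range.mp hl
      rw [div_le_iff₀ hm]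
      exact mul_le_mul_of_nonneg_left hl' hL
    rw [← intervalIntegral.integral_sub (by simp) (hg.intervalIntegrable _ _)]
    have := intervalIntegral.norm_integral_le_of_norm_le_const (a := a l) (b := a (l + 1))
      (f := fun x => g (a l) - g x) (C := ε / (L + 1)) ?_
    · rwa [hstep, abs_of_nonneg hLm, Real.norm_eq_abs] at this
    · intro x hx
      rw [Set.uIoc_of_le hal] at hx
      rw [← dist_eq_norm]
      refine (hδg _ ⟨ha0, by linarith⟩ _ ⟨by linarith [hx.1], by linarith [hx.2]⟩ ?_).le
      rw [Real.dist_eq, abs_sub_comm, abs_of_nonneg (by linarith [hx.1])]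
      linarith [hx.2, hstep l]
  refine (Finset.abs_sum_le_sum_abs _ _).trans_lt ((Finset.sum_le_sum hbound).trans_lt ?_)
  rw [Finset.sum_const, Finset.card_range, nsmul_eq_mul, ← hmdef]
  have : m * (ε / (L + 1) * (L / m)) = ε * (L / (L + 1)) := by field_simp
  rw [this]
  have : L / (L + 1) < 1 := by rw [div_lt_one (by positivity)]; linarith
  nlinarith

theorem continuous_energy {K : ℕ} (t : Fin K → ℝ) (f : Fin K → Polynomial ℂ) :
    Continuous (energy t f) := by
  unfold energy
  refine continuous_finsetSum _ fun k _ => continuous_const.mul ?_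
  exact (((f k).continuous.comp (by fun_prop)).norm).pow 2

open Filter Topology in
theorem integral_log_energy_dirichletPoly_le {K : ℕ} {N : Fin K → ℕ} {f : Fin K → Polynomial ℂ}
    (hf : ∀ k, f k ∈ LittlewoodPoly (N k)) (t : Fin K → ℝ) (ht : ∀ k, 0 ≤ t k) (s : ℝ)
    (hs : 0 ≤ s) :
    ∫ θ in 0..2 * Real.pi, Real.log (1 + s * energy t (fun k => dirichletPoly (N k)) θ) ≤
      ∫ θ in 0..2 * Real.pi, Real.log (1 + s * energy t f θ) := by
  choose c hc using fun k => exists_isSignCoeff (hf k)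
  have hpos : ∀ (f : Fin K → Polynomial ℂ) θ, 0 < 1 + s * energy t f θ := fun f θ =>
    add_pos_of_pos_of_nonneg one_pos (mul_nonneg hs (energy_nonneg ht f θ))
  have hcont : ∀ f : Fin K → Polynomial ℂ, Continuous fun θ => Real.log (1 + s * energy t f θ) :=
    fun f => (continuous_const.add (continuous_const.mul (continuous_energy t f))).log
      fun θ => (hpos f θ).ne'
  have h2pi : (0 : ℝ) ≤ 2 * Real.pi := by positivity
  set C : ℝ := ∏ k, (1 + s * t k * N k) ^ N k with hC
  have hCpos : 0 < C := Finset.prod_pos fun k _ => pow_pos (add_pos_of_pos_of_nonneg one_pos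
    (mul_nonneg (mul_nonneg hs (ht k)) (Nat.cast_nonneg _))) _
  -- C is independent of the number of sample points, so the mesh factor kills its logarithm.
  have hlim : Tendsto (fun q : ℕ => 2 * Real.pi / (q + 1 : ℕ) * Real.log C) atTop (𝓝 (0 * Real.log C)) := by
    refine Tendsto.mul_const _ ?_
    exact (tendsto_const_div_atTop_nhds_zero_nat (2 * Real.pi)).comp (tendsto_add_atTop_nat 1)
  have hR := (tendsto_riemann_sum h2pi (hcont f)).add hlim
  rw [zero_mul, add_zero] at hR
  refine le_of_tendsto_of_tendsto (tendsto_riemann_sum h2pi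
    (hcont fun k => dirichletPoly (N k))) hR ?_
  filter_upwards [eventually_ge_atTop (∑ k, N k)] with q hq
  have hm : ∀ k, N k ≤ q + 1 := fun k =>
    (Finset.single_le_sum (f := N) (fun _ _ => Nat.zero_le _) (Finset.mem_univ k)).trans (by omega)
  rw [← mul_add]
  refine mul_le_mul_of_nonneg_left ?_ (by positivity)
  rw [← Real.log_prod fun l _ => (hpos _ _).ne', ← Real.log_prod fun l _ => (hpos _ _).ne',
    ← Real.log_mul (Finset.prod_pos fun l _ => hpos _ _).ne' hCpos.ne']
  exact Real.log_le_log (Finset.prod_pos fun l _ => hpos _ _)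
    (prod_energy_dirichletPoly_le hc hm t ht s hs)

/-! ### From a kernel and its dilates to powers -/

theorem integrableOn_mul_rpow_Ioi {h : ℝ → ℝ} (hm : Measurable h) (hpos : ∀ s, 0 < s → 0 ≤ h s)
    {q α β A B : ℝ} (hα : q < α) (hβ : β < q) (h0 : ∀ s, 0 < s → h s ≤ A * s ^ α)
    (h1 : ∀ s, 0 < s → h s ≤ B * s ^ β) :
    IntegrableOn (fun s => h s * s ^ (-q - 1)) (Set.Ioi 0) := by
  have hmeas : Measurable fun s : ℝ => h s * s ^ (-q - 1) := hm.mul (by fun_prop)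
  have hdom : ∀ (C γ : ℝ), (∀ s, 0 < s → h s ≤ C * s ^ γ) → ∀ s, 0 < s →
      ‖h s * s ^ (-q - 1)‖ ≤ C * s ^ (γ - q - 1) := by
    intro C γ hC s hs
    rw [Real.norm_of_nonneg (mul_nonneg (hpos s hs) (Real.rpow_nonneg hs.le _)),
      show γ - q - 1 = γ + (-q - 1) by ring, Real.rpow_add hs, ← mul_assoc]
    exact mul_le_mul_of_nonneg_right (hC s hs) (Real.rpow_nonneg hs.le _)
  rw [← Set.Ioc_union_Ioi_eq_Ioi zero_le_one, integrableOn_union]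
  constructor
  · have hi : IntegrableOn (fun s : ℝ => A * s ^ (α - q - 1)) (Set.Ioc 0 1) := by
      have := intervalIntegral.intervalIntegrable_rpow' (a := 0) (b := 1)
        (r := α - q - 1) (by linarith)
      exact ((intervalIntegrable_iff_integrableOn_Ioc_of_le zero_le_one).mp this).const_mul A
    refine Integrable.mono' hi hmeas.aestronglyMeasurable ?_
    filter_upwards [ae_restrict_mem measurableSet_Ioc] with s hs
    exact hdom A α h0 s hs.1
  · have hi : IntegrableOn (fun s : ℝ => B * s ^ (β - q - 1)) (Set.Ioi 1) :=
      (integrableOn_Ioi_rpow_of_lt (by linarith) one_pos).const_mul B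
    refine Integrable.mono' hi hmeas.aestronglyMeasurable ?_
    filter_upwards [ae_restrict_mem measurableSet_Ioi] with s hs
    exact hdom B β h1 s (zero_lt_one.trans hs)

theorem lintegral_scale_mul_rpow {h : ℝ → ℝ} (hpos : ∀ s, 0 < s → 0 ≤ h s) (hzero : h 0 = 0)
    {q : ℝ} (hq : q ≠ 0)
    (hint : IntegrableOn (fun s => h s * s ^ (-q - 1)) (Set.Ioi 0)) {x : ℝ} (hx : 0 ≤ x) :
    ∫⁻ s in Set.Ioi (0 : ℝ), ENNReal.ofReal (h (s * x) * s ^ (-q - 1)) =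
      ENNReal.ofReal (∫ s in Set.Ioi (0 : ℝ), h s * s ^ (-q - 1)) * ENNReal.ofReal (x ^ q) := by
  rcases hx.eq_or_lt with rfl | hx
  · simp [hzero, Real.zero_rpow hq]
  have e : ∀ s ∈ Set.Ioi (0 : ℝ), h (s * x) * s ^ (-q - 1) =
      x ^ (q + 1) * (h (x * s) * (x * s) ^ (-q - 1)) := by
    intro s hs
    rw [Real.mul_rpow hx.le (le_of_lt hs), mul_comm s x]
    have : x ^ (q + 1) * x ^ (-q - 1) = 1 := by
      rw [← Real.rpow_add hx]; simp
    linear_combination (-h (x * s) * s ^ (-q - 1)) * this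
  have hint2 : IntegrableOn (fun s => x ^ (q + 1) * (h (x * s) * (x * s) ^ (-q - 1)))
      (Set.Ioi 0) := by
    refine Integrable.const_mul ?_ _
    have := (integrableOn_Ioi_comp_mul_left_iff (fun s => h s * s ^ (-q - 1)) 0 hx).mpr
      (by simpa using hint)
    exact this
  rw [setLIntegral_congr_fun measurableSet_Ioi fun s hs => by rw [e s hs],
    ← ofReal_integral_eq_lintegral_ofReal hint2, integral_const_mul,
    integral_comp_mul_left_Ioi (fun s => h s * s ^ (-q - 1)) 0 hx, mul_zero, smul_eq_mul,
    ← mul_assoc, ← Real.rpow_neg_one, ← Real.rpow_add hx, mul_comm, ENNReal.ofReal_mul']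
  · congr 3; ring
  · exact Real.rpow_nonneg hx.le _
  · filter_upwards [ae_restrict_mem measurableSet_Ioi] with s hs
    exact mul_nonneg (Real.rpow_nonneg hx.le _)
      (mul_nonneg (hpos _ (mul_pos hx hs)) (Real.rpow_nonneg (mul_pos hx hs).le _))

/-- Integral comparison for all dilates of `h` passes to the power `q`, when `h` grows faster than
the power `q` at `0` and slower at infinity. -/
theorem lintegral_rpow_le_of_scales {X : Type*} [MeasurableSpace X] {μ : Measure X} [SFinite μ]
    {h : ℝ → ℝ} (hm : Measurable h) (hpos : ∀ s, 0 < s → 0 < h s) (hzero : h 0 = 0)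
    {q α β A B : ℝ} (hq : q ≠ 0) (hα : q < α) (hβ : β < q) (h0 : ∀ s, 0 < s → h s ≤ A * s ^ α)
    (h1 : ∀ s, 0 < s → h s ≤ B * s ^ β) {F G : X → ℝ} (hF : Measurable F) (hG : Measurable G)
    (hF0 : ∀ x, 0 ≤ F x) (hG0 : ∀ x, 0 ≤ G x)
    (hFG : ∀ s, 0 < s → ∫⁻ x, ENNReal.ofReal (h (s * F x)) ∂μ ≤
      ∫⁻ x, ENNReal.ofReal (h (s * G x)) ∂μ) :
    ∫⁻ x, ENNReal.ofReal (F x ^ q) ∂μ ≤ ∫⁻ x, ENNReal.ofReal (G x ^ q) ∂μ := by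
  have hint := integrableOn_mul_rpow_Ioi hm (fun s hs => (hpos s hs).le) hα hβ h0 h1
  set c : ℝ := ∫ s in Set.Ioi (0 : ℝ), h s * s ^ (-q - 1) with hc
  have hgpos : ∀ s ∈ Set.Ioi (0 : ℝ), 0 < h s * s ^ (-q - 1) := fun s hs =>
    mul_pos (hpos s hs) (Real.rpow_pos_of_pos hs _)
  have hcpos : 0 < c := by
    rw [hc, setIntegral_pos_iff_support_of_nonneg_ae _ hint]
    · have : Function.support (fun s => h s * s ^ (-q - 1)) ∩ Set.Ioi 0 = Set.Ioi 0 :=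
        Set.inter_eq_right.mpr fun s hs => (hgpos s hs).ne'
      rw [this]; simp
    · filter_upwards [ae_restrict_mem measurableSet_Ioi] with s hs
      exact (hgpos s hs).le
  -- Substituting s ↦ s / H x represents c (H x)^q as an integral of h (s H x) over scales; Tonelli
  -- then exposes the quantities compared in `hFG`.
  have swap : ∀ H : X → ℝ, Measurable H → (∀ x, 0 ≤ H x) →
      ENNReal.ofReal c * ∫⁻ x, ENNReal.ofReal (H x ^ q) ∂μ =
        ∫⁻ s in Set.Ioi (0 : ℝ),
          (∫⁻ x, ENNReal.ofReal (h (s * H x)) ∂μ) * ENNReal.ofReal (s ^ (-q - 1)) := by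
    intro H hH hH0
    rw [← lintegral_const_mul _ (by fun_prop)]
    have e1 : ∀ x, ENNReal.ofReal c * ENNReal.ofReal (H x ^ q) =
        ∫⁻ s in Set.Ioi (0 : ℝ), ENNReal.ofReal (h (s * H x) * s ^ (-q - 1)) := fun x =>
      (lintegral_scale_mul_rpow (fun s hs => (hpos s hs).le) hzero hq hint (hH0 x)).symm
    simp_rw [e1]
    rw [lintegral_lintegral_swap]
    · refine setLIntegral_congr_fun measurableSet_Ioi fun s hs => ?_
      rw [← lintegral_mul_const _ (by fun_prop)]
      refine lintegral_congr fun x => ?_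
      rw [ENNReal.ofReal_mul' (Real.rpow_nonneg (le_of_lt hs) _)]
    · refine Measurable.aemeasurable ?_
      unfold Function.uncurry
      fun_prop
  have hle : ENNReal.ofReal c * ∫⁻ x, ENNReal.ofReal (F x ^ q) ∂μ ≤
      ENNReal.ofReal c * ∫⁻ x, ENNReal.ofReal (G x ^ q) ∂μ := by
    rw [swap F hF hF0, swap G hG hG0]
    refine setLIntegral_mono' measurableSet_Ioi fun s hs => ?_
    exact mul_le_mul' (hFG s hs) le_rfl
  exact (ENNReal.mul_le_mul_iff_right (by simpa using hcpos) ENNReal.ofReal_ne_top).mp hle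

/-- Combines log y ≤ y - 1 at y = (1 + s)^ε with subadditivity of the power ε. The value ε = 1
serves near 0, a small ε at infinity. -/
theorem log_one_add_le_rpow {ε s : ℝ} (hε : 0 < ε) (hε1 : ε ≤ 1) (hs : 0 < s) :
    Real.log (1 + s) ≤ ε⁻¹ * s ^ ε := by
  have h1 : (1 + s) ^ ε ≤ 1 + s ^ ε := by
    simpa using Real.rpow_add_le_add_rpow zero_le_one hs.le hε.le hε1
  have h2 : ε * Real.log (1 + s) ≤ s ^ ε := by
    rw [← Real.log_rpow (by positivity)]
    have := Real.log_le_sub_one_of_pos (x := (1 + s) ^ ε) (by positivity)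
    linarith
  rw [le_inv_mul_iff₀ hε]
  exact h2

theorem sub_log_one_add_pos {s : ℝ} (hs : 0 < s) : 0 < s - Real.log (1 + s) := by
  have := Real.log_lt_sub_one_of_pos (x := 1 + s) (by positivity) (by linarith)
  linarith

theorem sub_log_one_add_le_sq {s : ℝ} (hs : 0 < s) : s - Real.log (1 + s) ≤ s ^ 2 := by
  have := Real.one_sub_inv_le_log_of_pos (x := 1 + s) (by positivity)
  have h2 : s - (1 - (1 + s)⁻¹) ≤ s ^ 2 := by
    have : s ^ 2 - (s - (1 - (1 + s)⁻¹)) = s ^ 3 / (1 + s) := by field_simp; ring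
    have h3 : 0 ≤ s ^ 3 / (1 + s) := by positivity
    linarith
  linarith

/-! ### Parseval for sign polynomials -/

theorem integral_cos_int_mul {n : ℤ} (hn : n ≠ 0) :
    ∫ θ in 0..2 * Real.pi, Real.cos (n * θ) = 0 := by
  have hn' : (n : ℝ) ≠ 0 := by exact_mod_cast hn
  rw [intervalIntegral.integral_comp_mul_left _ hn', integral_cos]
  have : Real.sin (n * (2 * Real.pi)) = 0 := by
    have := Real.sin_int_mul_pi (n * 2)
    push_cast at this
    rw [← this]; ring_nf
  simp [this]

theorem IsSignCoeff.sq_norm_eval {N : ℕ} {c : ℕ → ℤ} {f : Polynomial ℂ} (h : IsSignCoeff N c f)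
    (θ : ℝ) : ‖f.eval (Complex.exp (θ * Complex.I))‖ ^ 2 =
      ∑ i ∈ Finset.range N, ∑ j ∈ Finset.range N,
        (c i * c j : ℝ) * Real.cos (((i - j : ℤ) : ℝ) * θ) := by
  have e : f.eval (Complex.exp (θ * Complex.I)) = ∑ j ∈ Finset.range N,
      (((c j * Real.cos (j * θ) : ℝ) : ℂ) + ((c j * Real.sin (j * θ) : ℝ) : ℂ) * Complex.I) := by
    rw [h.eq_sum, Polynomial.eval_finsetSum]
    refine Finset.sum_congr rfl fun j _ => ?_
    rw [Polynomial.eval_mul, Polynomial.eval_C, Polynomial.eval_pow, Polynomial.eval_X,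
      ← Complex.exp_nat_mul, ← mul_assoc, Complex.exp_mul_I]
    push_cast
    ring
  rw [e, Finset.sum_add_distrib, ← Finset.sum_mul, ← Complex.ofReal_sum, ← Complex.ofReal_sum,
    Complex.sq_norm, Complex.normSq_add_mul_I, sq, sq, Finset.sum_mul_sum, Finset.sum_mul_sum,
    ← Finset.sum_add_distrib]
  refine Finset.sum_congr rfl fun i _ => ?_
  rw [← Finset.sum_add_distrib]
  refine Finset.sum_congr rfl fun j _ => ?_
  push_cast
  rw [sub_mul, Real.cos_sub]
  ring

theorem IsSignCoeff.integral_sq_norm_eval {N : ℕ} {c : ℕ → ℤ} {f : Polynomial ℂ}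
    (h : IsSignCoeff N c f) :
    ∫ θ in 0..2 * Real.pi, ‖f.eval (Complex.exp ((θ : ℝ) * Complex.I))‖ ^ 2 =
      2 * Real.pi * N := by
  simp_rw [h.sq_norm_eval]
  have hi : ∀ i j : ℕ, IntervalIntegrable (fun θ : ℝ => (c i * c j : ℝ) *
      Real.cos (((i - j : ℤ) : ℝ) * θ)) volume 0 (2 * Real.pi) := fun i j =>
    Continuous.intervalIntegrable (by fun_prop) _ _
  rw [intervalIntegral.integral_finsetSum fun i _ => by
    exact Continuous.intervalIntegrable (by fun_prop) _ _]
  have : ∀ i ∈ Finset.range N, ∫ θ in 0..2 * Real.pi, ∑ j ∈ Finset.range N,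
      (c i * c j : ℝ) * Real.cos (((i - j : ℤ) : ℝ) * θ) = 2 * Real.pi := by
    intro i hiN
    rw [intervalIntegral.integral_finsetSum fun j _ => hi i j, Finset.sum_eq_single i]
    · have hc : (c i * c i : ℝ) = 1 := by
        rcases h.sign i (Finset.mem_range.mp hiN) with e | e <;> rw [e] <;> norm_num
      simp [hc]
    · intro j _ hj
      rw [intervalIntegral.integral_const_mul, integral_cos_int_mul (by omega), mul_zero]
    · exact fun hi' => absurd hiN hi'
  rw [Finset.sum_congr rfl this, Finset.sum_const, Finset.card_range, nsmul_eq_mul]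
  ring

theorem integral_energy {K : ℕ} {N : Fin K → ℕ} {f : Fin K → Polynomial ℂ}
    (hf : ∀ k, f k ∈ LittlewoodPoly (N k)) (t : Fin K → ℝ) :
    ∫ θ in 0..2 * Real.pi, energy t f θ = ∑ k, t k * (2 * Real.pi * N k) := by
  choose c hc using fun k => exists_isSignCoeff (hf k)
  unfold energy
  rw [intervalIntegral.integral_finsetSum]
  · refine Finset.sum_congr rfl fun k _ => ?_
    rw [intervalIntegral.integral_const_mul, (hc k).integral_sq_norm_eval]
  · intro k _
    exact Continuous.intervalIntegrable (continuous_const.mul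
      ((((f k).continuous.comp (by fun_prop)).norm).pow 2)) _ _

theorem dirichletPoly_mem (N : ℕ) : dirichletPoly N ∈ LittlewoodPoly N :=
  ⟨fun _ => 1, fun _ => Or.inl rfl, by
    simp [dirichletPoly, Fin.sum_univ_eq_sum_range (fun j => (Polynomial.X : Polynomial ℂ) ^ j)]⟩

theorem integrable_restrict_of_continuous {g : ℝ → ℝ} (hg : Continuous g) (a b : ℝ) :
    Integrable g (volume.restrict (Set.Ioc a b)) :=
  (hg.integrableOn_Icc (a := a) (b := b)).mono_set Set.Ioc_subset_Icc_self

theorem lintegral_ofReal_eq_intervalIntegral {g : ℝ → ℝ} (hg : Continuous g) (h0 : ∀ x, 0 ≤ g x)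
    {a b : ℝ} (hab : a ≤ b) :
    ∫⁻ x in Set.Ioc a b, ENNReal.ofReal (g x) = ENNReal.ofReal (∫ x in a..b, g x) := by
  rw [intervalIntegral.integral_of_le hab, ofReal_integral_eq_lintegral_ofReal
    (integrable_restrict_of_continuous hg a b) (Filter.Eventually.of_forall h0)]

/-! ### Comparison of the moments of the energy -/

section comparison

variable {K : ℕ} {N : Fin K → ℕ} {f : Fin K → Polynomial ℂ} {t : Fin K → ℝ}

theorem lintegral_energy_rpow_le_of_lt_one (hf : ∀ k, f k ∈ LittlewoodPoly (N k))
    (ht : ∀ k, 0 ≤ t k) {q : ℝ} (hq : 0 < q) (hq1 : q < 1) :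
    ∫⁻ θ in Set.Ioc 0 (2 * Real.pi),
        ENNReal.ofReal (energy t (fun k => dirichletPoly (N k)) θ ^ q) ≤
      ∫⁻ θ in Set.Ioc 0 (2 * Real.pi), ENNReal.ofReal (energy t f θ ^ q) := by
  have h2pi : (0 : ℝ) ≤ 2 * Real.pi := by positivity
  refine lintegral_rpow_le_of_scales (h := fun s => Real.log (1 + s)) (by fun_prop)
    (fun s hs => Real.log_pos (by linarith)) (by simp) hq.ne' hq1 (half_lt_self hq)
    (fun s hs => log_one_add_le_rpow one_pos le_rfl hs)
    (fun s hs => log_one_add_le_rpow (half_pos hq) (by linarith) hs)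
    (continuous_energy _ _).measurable (continuous_energy _ _).measurable
    (energy_nonneg ht _) (energy_nonneg ht _) fun s hs => ?_
  have hn : ∀ (g : Fin K → Polynomial ℂ) θ, 0 ≤ s * energy t g θ := fun g θ =>
    mul_nonneg hs.le (energy_nonneg ht g θ)
  have hcont : ∀ g : Fin K → Polynomial ℂ, Continuous fun θ => Real.log (1 + s * energy t g θ) :=
    fun g => (continuous_const.add (continuous_const.mul (continuous_energy t g))).log
      fun θ => (add_pos_of_pos_of_nonneg one_pos (hn g θ)).ne'
  rw [lintegral_ofReal_eq_intervalIntegral (hcont _)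
      (fun θ => Real.log_nonneg (le_add_of_nonneg_right (hn _ θ))) h2pi,
    lintegral_ofReal_eq_intervalIntegral (hcont _)
      (fun θ => Real.log_nonneg (le_add_of_nonneg_right (hn _ θ))) h2pi]
  exact ENNReal.ofReal_le_ofReal (integral_log_energy_dirichletPoly_le hf t ht s hs.le)

/-- The kernel s - log(1 + s) is quadratic at 0 and linear at infinity, which covers 1 < q < 2. Its
linear part integrates to the same value for f and D, and the minus sign reverses the logarithmic
inequality. -/
theorem lintegral_energy_rpow_le_of_one_lt (hf : ∀ k, f k ∈ LittlewoodPoly (N k))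
    (ht : ∀ k, 0 ≤ t k) {q : ℝ} (hq : 1 < q) (hq2 : q < 2) :
    ∫⁻ θ in Set.Ioc 0 (2 * Real.pi), ENNReal.ofReal (energy t f θ ^ q) ≤
      ∫⁻ θ in Set.Ioc 0 (2 * Real.pi),
        ENNReal.ofReal (energy t (fun k => dirichletPoly (N k)) θ ^ q) := by
  have h2pi : (0 : ℝ) ≤ 2 * Real.pi := by positivity
  refine lintegral_rpow_le_of_scales (h := fun s => s - Real.log (1 + s)) (α := 2) (β := 1)
    (A := 1) (B := 1) (by fun_prop) (fun s hs => sub_log_one_add_pos hs) (by simp) (by linarith)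
    hq2 hq (fun s hs => by simpa using sub_log_one_add_le_sq hs)
    (fun s hs => by simpa using Real.log_nonneg (by linarith : 1 ≤ 1 + s))
    (continuous_energy _ _).measurable (continuous_energy _ _).measurable
    (energy_nonneg ht _) (energy_nonneg ht _) fun s hs => ?_
  have hn : ∀ (g : Fin K → Polynomial ℂ) θ, 0 ≤ s * energy t g θ := fun g θ =>
    mul_nonneg hs.le (energy_nonneg ht g θ)
  have hlog : ∀ g : Fin K → Polynomial ℂ, Continuous fun θ => Real.log (1 + s * energy t g θ) :=
    fun g => (continuous_const.add (continuous_const.mul (continuous_energy t g))).log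
      fun θ => (add_pos_of_pos_of_nonneg one_pos (hn g θ)).ne'
  have hlin : ∀ g : Fin K → Polynomial ℂ, Continuous fun θ => s * energy t g θ :=
    fun g => continuous_const.mul (continuous_energy t g)
  have hsub : ∀ g : Fin K → Polynomial ℂ,
      Continuous fun θ => s * energy t g θ - Real.log (1 + s * energy t g θ) :=
    fun g => (hlin g).sub (hlog g)
  have hnn : ∀ (g : Fin K → Polynomial ℂ) θ,
      0 ≤ s * energy t g θ - Real.log (1 + s * energy t g θ) := by
    intro g θ
    rcases (hn g θ).eq_or_lt with h | h
    · simp [← h]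
    · exact (sub_log_one_add_pos h).le
  rw [lintegral_ofReal_eq_intervalIntegral (hsub _) (hnn _) h2pi,
    lintegral_ofReal_eq_intervalIntegral (hsub _) (hnn _) h2pi]
  refine ENNReal.ofReal_le_ofReal ?_
  rw [intervalIntegral.integral_sub ((hlin _).intervalIntegrable _ _)
      ((hlog _).intervalIntegrable _ _),
    intervalIntegral.integral_sub ((hlin _).intervalIntegrable _ _)
      ((hlog _).intervalIntegrable _ _), intervalIntegral.integral_const_mul,
    intervalIntegral.integral_const_mul, integral_energy hf,
    integral_energy fun k => dirichletPoly_mem (N k)]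
  exact sub_le_sub_left (integral_log_energy_dirichletPoly_le hf t ht s hs.le) _

theorem lintegral_energy_rpow_one (hf : ∀ k, f k ∈ LittlewoodPoly (N k)) (ht : ∀ k, 0 ≤ t k) :
    ∫⁻ θ in Set.Ioc 0 (2 * Real.pi),
        ENNReal.ofReal (energy t (fun k => dirichletPoly (N k)) θ ^ (1 : ℝ)) =
      ∫⁻ θ in Set.Ioc 0 (2 * Real.pi), ENNReal.ofReal (energy t f θ ^ (1 : ℝ)) := by
  have h2pi : (0 : ℝ) ≤ 2 * Real.pi := by positivity
  simp only [Real.rpow_one]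
  rw [lintegral_ofReal_eq_intervalIntegral (continuous_energy _ _) (energy_nonneg ht _) h2pi,
    lintegral_ofReal_eq_intervalIntegral (continuous_energy _ _) (energy_nonneg ht _) h2pi,
    integral_energy hf, integral_energy fun k => dirichletPoly_mem (N k)]

-- At q = 2 the kernel integral diverges at 0, so this endpoint is reached by dominated convergence
-- as q increases to 2, with majorant 1 + E².
open Filter Topology in
theorem tendsto_lintegral_energy_rpow (g : Fin K → Polynomial ℂ) (ht : ∀ k, 0 ≤ t k) :
    Tendsto (fun q : ℝ => ∫⁻ θ in Set.Ioc 0 (2 * Real.pi), ENNReal.ofReal (energy t g θ ^ q))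
      (𝓝[<] 2) (𝓝 (∫⁻ θ in Set.Ioc 0 (2 * Real.pi), ENNReal.ofReal (energy t g θ ^ (2 : ℝ)))) := by
  have hE := continuous_energy t g
  refine tendsto_lintegral_filter_of_dominated_convergence
    (fun θ => ENNReal.ofReal (1 + energy t g θ ^ 2)) ?_ ?_ ?_ ?_
  · exact Eventually.of_forall fun q => by fun_prop
  · filter_upwards [Ioo_mem_nhdsLT (show (1 : ℝ) < 2 by norm_num)] with q hq
    refine Eventually.of_forall fun θ => ENNReal.ofReal_le_ofReal ?_
    have h0 := energy_nonneg ht g θ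
    rcases le_total (energy t g θ) 1 with h | h
    · have := Real.rpow_le_one h0 h (by linarith [hq.1] : 0 ≤ q)
      nlinarith
    · have := Real.rpow_le_rpow_of_exponent_le h hq.2.le
      rw [Real.rpow_two] at this
      linarith
  · exact (integrable_restrict_of_continuous (by fun_prop) _ _).lintegral_lt_top.ne
  · refine Eventually.of_forall fun θ => ENNReal.tendsto_ofReal ?_
    exact ((Real.continuousAt_const_rpow' (by norm_num)).tendsto).mono_left nhdsWithin_le_nhds

open Filter Topology in
theorem lintegral_energy_rpow_two_le (hf : ∀ k, f k ∈ LittlewoodPoly (N k))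
    (ht : ∀ k, 0 ≤ t k) :
    ∫⁻ θ in Set.Ioc 0 (2 * Real.pi), ENNReal.ofReal (energy t f θ ^ (2 : ℝ)) ≤
      ∫⁻ θ in Set.Ioc 0 (2 * Real.pi),
        ENNReal.ofReal (energy t (fun k => dirichletPoly (N k)) θ ^ (2 : ℝ)) := by
  refine le_of_tendsto_of_tendsto (tendsto_lintegral_energy_rpow f ht)
    (tendsto_lintegral_energy_rpow (fun k => dirichletPoly (N k)) ht) ?_
  filter_upwards [Ioo_mem_nhdsLT (show (1 : ℝ) < 2 by norm_num)] with q hq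
  exact lintegral_energy_rpow_le_of_one_lt hf ht hq.1 hq.2

theorem circleLpNorm_squareFunction (g : Fin K → Polynomial ℂ) (ht : ∀ k, 0 ≤ t k) {p : ℝ}
    (hp : 0 < p) : circleLpNorm p (squareFunction t g) =
      (∫⁻ θ in Set.Ioc 0 (2 * Real.pi), ENNReal.ofReal (energy t g θ ^ (p / 2))) ^ (1 / p) := by
  rw [circleLpNorm, eLpNorm_eq_lintegral_rpow_enorm_toReal (by simpa using hp)
    ENNReal.ofReal_ne_top, ENNReal.toReal_ofReal hp.le]
  congr 1
  refine lintegral_congr fun θ => ?_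
  have h0 := energy_nonneg ht g θ
  change ‖Real.sqrt (energy t g θ)‖ₑ ^ p = _
  rw [Real.enorm_of_nonneg (Real.sqrt_nonneg _), ENNReal.ofReal_rpow_of_nonneg (Real.sqrt_nonneg _)
    hp.le, Real.sqrt_eq_rpow, ← Real.rpow_mul h0]
  congr 2
  ring

end comparison

theorem mainTheorem3 (K : ℕ) (hK : 1 ≤ K) (N : Fin K → ℕ) (hN : ∀ k, 1 ≤ N k)
    (f : Fin K → Polynomial ℂ) (hf : ∀ k, f k ∈ LittlewoodPoly (N k))
    (t : Fin K → ℝ) (ht : ∀ k, 0 < t k) :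
    (∀ p : ℝ, 0 < p → p ≤ 2 →
      circleLpNorm p (squareFunction t fun k => dirichletPoly (N k)) ≤
        circleLpNorm p (squareFunction t f)) ∧
    (∀ p : ℝ, 2 ≤ p → p ≤ 4 →
      circleLpNorm p (squareFunction t f) ≤
        circleLpNorm p (squareFunction t fun k => dirichletPoly (N k))) := by
  have ht' : ∀ k, 0 ≤ t k := fun k => (ht k).le
  constructor
  · intro p hp hp2
    rw [circleLpNorm_squareFunction _ ht' hp, circleLpNorm_squareFunction _ ht' hp]
    refine ENNReal.rpow_le_rpow ?_ (by positivity)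
    rcases hp2.eq_or_lt with rfl | hlt
    · rw [div_self two_ne_zero]
      exact (lintegral_energy_rpow_one hf ht').le
    · exact lintegral_energy_rpow_le_of_lt_one hf ht' (by positivity) (by linarith)
  · intro p hp2 hp4
    have hp : 0 < p := by linarith
    rw [circleLpNorm_squareFunction _ ht' hp, circleLpNorm_squareFunction _ ht' hp]
    refine ENNReal.rpow_le_rpow ?_ (by positivity)
    rcases hp2.eq_or_lt with rfl | hlt
    · rw [div_self two_ne_zero]
      exact (lintegral_energy_rpow_one hf ht').ge
    · rcases hp4.eq_or_lt with rfl | hlt4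
      · rw [show (4 : ℝ) / 2 = 2 by norm_num]
        exact lintegral_energy_rpow_two_le hf ht'
      · exact lintegral_energy_rpow_le_of_one_lt hf ht' (by linarith) (by linarith)
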